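/- Let $X$ be a connected, non-compact metric space in which all closed balls are compact, equipped with a Borel measure $m$ such that no non-zero operator of multiplication by a function $f\in C_0(X)$ on $L^2(X)=L^2(X,m)$ is compact (for example, such that $m$ has no atoms). Suppose that $X$ has bounded geometry: there is $r>0$ such that for every $R>0$ there is $N\in\mathbb N$ such that every ball of radius $R$ is covered by at most $N$ balls of radius $r$. Let $D\subset X$ be uniformly discrete (there is $\varepsilon>0$ with $d(x,y)\ge\varepsilon$ for all distinct $x,y\in D$) and coarsely equivalent to $X$ (there is $C>0$ such that every $x\in X$ satisfies $d(x,y)<C$ for some $y\in D$). Let $\{\phi_x\}_{x\in D}\subset L^2(X)$ be a Wannier basis with localization centers $D$, that is: $\|\phi_x\|_2=1$ and $x\in\operatorname{supp}\phi_x$ for all $x\in D$; $\operatorname{supp}\phi_x\cap\operatorname{supp}\phi_y=\emptyset$ for $x\ne y$; and the diameters of the sets $\operatorname{supp}\phi_x$, $x\in D$, are uniformly bounded. Here $\operatorname{supp}$ is the essential support, i.e. the complement of the largest open set on which the function vanishes almost everywhere. Let $p_\phi$ be the orthogonal projection of $L^2(X)$ onto the closed linear span of $\{\phi_x:x\in D\}$.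 Let $C^*(X)\subset\mathbb B(L^2(X))$ be the Roe algebra, i.e. the norm closure of the $*$-algebra of the bounded operators $T$ that are locally compact ($Tf$ and $fT$ are compact for all $f\in C_0(X)$, acting by multiplication) and have finite propagation (there is $R>0$ such that $fTg=0$ for all $f,g\in C_0(X)$ whose supports are at distance greater than $R$). Then $p_\phi\in C^*(X)$ and $[p_\phi]=0$ in $K_0(C^*(X))$. -/

import Mathlib

open MeasureTheory Topology
open scoped ENNReal ZeroAtInfty Matrix

noncomputable section

/-! ## The group `K₀` of a `C*`-algebra

For a unital algebra `R`, `K₀(R)` is the Grothendieck group of the monoid of Murray-von Neumann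
classes of projections in matrices of all sizes over `R`. For an algebra `A` not assumed unital,
`K₀(A)` is the kernel of the map `K₀(A⁺) → K₀(ℂ)` induced by the augmentation `A⁺ → ℂ`, where
`A⁺` is the unitization of `A`. -/

namespace KTheory

section Unital

variable {R : Type*} [Ring R] [StarRing R]

/-- Murray-von Neumann equivalence of square matrices `p`, `q`, possibly of different sizes:
`p = v* v` and `q = v v*` for some rectangular matrix `v`. -/
def MvN {m n : Type*} [Fintype m] [Fintype n] (p : Matrix m m R) (q : Matrix n n R) : Prop :=
  ∃ v : Matrix n m R, vᴴ * v = p ∧ v * vᴴ = q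

theorem MvN.refl {m : Type*} [Fintype m] {p : Matrix m m R} (hp : IsStarProjection p) :
    MvN p p := by
  have h1 : pᴴ = p := hp.isSelfAdjoint
  have h2 : p * p = p := hp.isIdempotentElem
  exact ⟨p, by rw [h1, h2], by rw [h1, h2]⟩

theorem MvN.symm {m n : Type*} [Fintype m] [Fintype n] {p : Matrix m m R} {q : Matrix n n R}
    (h : MvN p q) : MvN q p := by
  obtain ⟨v, h1, h2⟩ := h
  exact ⟨vᴴ, by rw [Matrix.conjTranspose_conjTranspose, h2],
    by rw [Matrix.conjTranspose_conjTranspose, h1]⟩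

theorem MvN.trans {l m n : Type*} [Fintype l] [Fintype m] [Fintype n]
    {p : Matrix l l R} {q : Matrix m m R} {r : Matrix n n R}
    (hp : IsStarProjection p) (hr : IsStarProjection r)
    (h : MvN p q) (h' : MvN q r) : MvN p r := by
  obtain ⟨v, h1, h2⟩ := h
  obtain ⟨w, h3, h4⟩ := h'
  have hp2 : p * p = p := hp.isIdempotentElem
  have hr2 : r * r = r := hr.isIdempotentElem
  refine ⟨w * v, ?_, ?_⟩
  · calc (w * v)ᴴ * (w * v) = vᴴ * (wᴴ * w) * v := by
          simp only [Matrix.conjTranspose_mul, Matrix.mul_assoc]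
      _ = (vᴴ * v) * (vᴴ * v) := by rw [h3, ← h2]; simp only [Matrix.mul_assoc]
      _ = p := by rw [h1, hp2]
  · calc (w * v) * (w * v)ᴴ = w * (v * vᴴ) * wᴴ := by
          simp only [Matrix.conjTranspose_mul, Matrix.mul_assoc]
      _ = (w * wᴴ) * (w * wᴴ) := by rw [h2, ← h3]; simp only [Matrix.mul_assoc]
      _ = r := by rw [h4, hr2]

/-- Relabelling the rows and columns of a projection gives an equivalent projection. -/
theorem MvN.submatrix {m n : Type*} [Fintype m] [Fintype n]
    {p : Matrix m m R} (hp : IsStarProjection p) (e : n ≃ m) : MvN p (p.submatrix e e) := by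
  have h1 : pᴴ = p := hp.isSelfAdjoint
  have h2 : p * p = p := hp.isIdempotentElem
  refine ⟨p.submatrix e id, ?_, ?_⟩
  · rw [Matrix.conjTranspose_submatrix, h1, Matrix.submatrix_mul_equiv, h2, Matrix.submatrix_id_id]
  · rw [Matrix.conjTranspose_submatrix, h1,
      ← Matrix.submatrix_mul p p e id e Function.bijective_id, h2]

theorem isStarProjection_submatrix {m n : Type*} [Fintype m] [Fintype n]
    {p : Matrix m m R} (hp : IsStarProjection p) (e : n ≃ m) :
    IsStarProjection (p.submatrix e e) := by
  have h1 : pᴴ = p := hp.isSelfAdjoint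
  have h2 : p * p = p := hp.isIdempotentElem
  constructor
  · change _ * _ = _
    rw [Matrix.submatrix_mul_equiv, h2]
  · change (p.submatrix e e)ᴴ = _
    rw [Matrix.conjTranspose_submatrix, h1]

/-- The block sum `p ⊕ q = diag(p, q)`. -/
def blockSum {m n : Type*} (p : Matrix m m R) (q : Matrix n n R) : Matrix (m ⊕ n) (m ⊕ n) R :=
  Matrix.fromBlocks p 0 0 q

theorem isStarProjection_blockSum {m n : Type*} [Fintype m] [Fintype n]
    {p : Matrix m m R} {q : Matrix n n R} (hp : IsStarProjection p) (hq : IsStarProjection q) :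
    IsStarProjection (blockSum p q) := by
  have h1 : pᴴ = p := hp.isSelfAdjoint
  have h2 : p * p = p := hp.isIdempotentElem
  have h3 : qᴴ = q := hq.isSelfAdjoint
  have h4 : q * q = q := hq.isIdempotentElem
  constructor
  · change _ * _ = _
    simp [blockSum, Matrix.fromBlocks_multiply, h2, h4]
  · change (blockSum p q)ᴴ = _
    simp [blockSum, Matrix.fromBlocks_conjTranspose, h1, h3]

theorem MvN.blockSum {m n m' n' : Type*} [Fintype m] [Fintype n] [Fintype m'] [Fintype n']
    {p : Matrix m m R} {q : Matrix n n R} {p' : Matrix m' m' R} {q' : Matrix n' n' R}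
    (h : MvN p p') (h' : MvN q q') : MvN (blockSum p q) (blockSum p' q') := by
  obtain ⟨v, h1, h2⟩ := h
  obtain ⟨w, h3, h4⟩ := h'
  refine ⟨Matrix.fromBlocks v 0 0 w, ?_, ?_⟩
  · simp [KTheory.blockSum, Matrix.fromBlocks_multiply, Matrix.fromBlocks_conjTranspose, h1, h3]
  · simp [KTheory.blockSum, Matrix.fromBlocks_multiply, Matrix.fromBlocks_conjTranspose, h2, h4]

variable (R) in
/-- Projections in the matrix algebras `Mₙ(R)`, `n = 0, 1, 2, …`. -/
abbrev MatProj : Type _ := Σ n : ℕ, {p : Matrix (Fin n) (Fin n) R // IsStarProjection p}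

variable (R) in
/-- Murray-von Neumann equivalence of projections in the matrix algebras over `R`. -/
instance matProjSetoid : Setoid (MatProj R) where
  r p q := MvN p.2.1 q.2.1
  iseqv := ⟨fun p => MvN.refl p.2.2, fun h => h.symm, fun {p _ r} h h' => h.trans p.2.2 r.2.2 h'⟩

/-- The sum `p ⊕ q ∈ M_{m+n}(R)` of projections `p ∈ Mₘ(R)`, `q ∈ Mₙ(R)`. -/
def MatProj.add (p q : MatProj R) : MatProj R :=
  ⟨p.1 + q.1, (blockSum p.2.1 q.2.1).submatrix finSumFinEquiv.symm finSumFinEquiv.symm,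
    isStarProjection_submatrix (isStarProjection_blockSum p.2.2 q.2.2) _⟩

theorem MatProj.mvn_add (p q : MatProj R) : MvN (blockSum p.2.1 q.2.1) (p.add q).2.1 :=
  MvN.submatrix (isStarProjection_blockSum p.2.2 q.2.2) _

variable (R) in
/-- The monoid of Murray-von Neumann classes of projections in matrices over `R`. -/
def ProjMonoid : Type _ := Quotient (matProjSetoid R)

/-- The Murray-von Neumann class of a projection. -/
def ProjMonoid.mk (p : MatProj R) : ProjMonoid R := Quotient.mk _ p

theorem MatProj.add_congr {p p' q q' : MatProj R} (h : MvN p.2.1 p'.2.1) (h' : MvN q.2.1 q'.2.1) :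
    MvN (p.add q).2.1 (p'.add q').2.1 :=
  MvN.trans (p.add q).2.2 (p'.add q').2.2
    (MvN.trans (p.add q).2.2 (isStarProjection_blockSum p'.2.2 q'.2.2)
      (p.mvn_add q).symm (h.blockSum h')) (p'.mvn_add q')

theorem MvN.blockSum_comm {m n : Type*} [Fintype m] [Fintype n]
    {p : Matrix m m R} {q : Matrix n n R} (hp : IsStarProjection p) (hq : IsStarProjection q) :
    MvN (KTheory.blockSum p q) (KTheory.blockSum q p) := by
  have h := MvN.submatrix (isStarProjection_blockSum hp hq) (Equiv.sumComm n m)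
  have e : (KTheory.blockSum p q).submatrix (Equiv.sumComm n m) (Equiv.sumComm n m)
      = KTheory.blockSum q p := by
    ext i j
    rcases i with i | i <;> rcases j with j | j <;> rfl
  rwa [e] at h

theorem MvN.blockSum_assoc {l m n : Type*} [Fintype l] [Fintype m] [Fintype n]
    {p : Matrix l l R} {q : Matrix m m R} {r : Matrix n n R} (hp : IsStarProjection p)
    (hq : IsStarProjection q) (hr : IsStarProjection r) :
    MvN (KTheory.blockSum (KTheory.blockSum p q) r)
      (KTheory.blockSum p (KTheory.blockSum q r)) := by
  have h := MvN.submatrix (isStarProjection_blockSum (isStarProjection_blockSum hp hq) hr)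
    (Equiv.sumAssoc l m n).symm
  have e : (KTheory.blockSum (KTheory.blockSum p q) r).submatrix (Equiv.sumAssoc l m n).symm
      (Equiv.sumAssoc l m n).symm = KTheory.blockSum p (KTheory.blockSum q r) := by
    ext i j
    rcases i with i | i | i <;> rcases j with j | j | j <;> rfl
  rwa [e] at h

theorem MvN.blockSum_empty {l m : Type*} [Fintype l] [Fintype m] [IsEmpty l]
    {p : Matrix l l R} {q : Matrix m m R} (hp : IsStarProjection p) (hq : IsStarProjection q) :
    MvN (KTheory.blockSum p q) q := by
  have h := MvN.submatrix (isStarProjection_blockSum hp hq) (Equiv.emptySum l m).symm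
  have e : (KTheory.blockSum p q).submatrix (Equiv.emptySum l m).symm (Equiv.emptySum l m).symm
      = q := by
    ext i j
    rfl
  rwa [e] at h

instance : Zero (ProjMonoid R) := ⟨ProjMonoid.mk ⟨0, 0, IsStarProjection.zero _⟩⟩

instance : Add (ProjMonoid R) :=
  ⟨Quotient.map₂ MatProj.add fun _ _ h _ _ h' => MatProj.add_congr h h'⟩

instance : AddCommMonoid (ProjMonoid R) where
  nsmul := nsmulRec
  add_assoc := by
    rintro ⟨p⟩ ⟨q⟩ ⟨r⟩
    refine Quotient.sound ?_
    change MvN ((p.add q).add r).2.1 (p.add (q.add r)).2.1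
    have h1 : MvN ((p.add q).add r).2.1 (blockSum (blockSum p.2.1 q.2.1) r.2.1) :=
      MvN.trans (MatProj.add _ _).2.2
        (isStarProjection_blockSum (isStarProjection_blockSum p.2.2 q.2.2) r.2.2)
        (MatProj.mvn_add _ _).symm ((MatProj.mvn_add _ _).symm.blockSum (MvN.refl r.2.2))
    have h2 : MvN (p.add (q.add r)).2.1 (blockSum p.2.1 (blockSum q.2.1 r.2.1)) :=
      MvN.trans (MatProj.add _ _).2.2
        (isStarProjection_blockSum p.2.2 (isStarProjection_blockSum q.2.2 r.2.2))
        (MatProj.mvn_add _ _).symm ((MvN.refl p.2.2).blockSum (MatProj.mvn_add _ _).symm)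
    exact MvN.trans (MatProj.add _ _).2.2 (MatProj.add _ _).2.2
      (MvN.trans (MatProj.add _ _).2.2
        (isStarProjection_blockSum p.2.2 (isStarProjection_blockSum q.2.2 r.2.2)) h1
        (MvN.blockSum_assoc p.2.2 q.2.2 r.2.2)) h2.symm
  add_comm := by
    rintro ⟨p⟩ ⟨q⟩
    refine Quotient.sound ?_
    change MvN (p.add q).2.1 (q.add p).2.1
    exact MvN.trans (MatProj.add _ _).2.2 (MatProj.add _ _).2.2
      (MvN.trans (MatProj.add _ _).2.2 (isStarProjection_blockSum q.2.2 p.2.2)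
        (p.mvn_add q).symm (MvN.blockSum_comm p.2.2 q.2.2)) (q.mvn_add p)
  zero_add := by
    rintro ⟨p⟩
    refine Quotient.sound ?_
    change MvN (MatProj.add _ p).2.1 p.2.1
    exact MvN.trans (MatProj.add _ _).2.2 p.2.2 (MatProj.mvn_add _ p).symm
      (MvN.blockSum_empty (IsStarProjection.zero _) p.2.2)
  add_zero := by
    rintro ⟨p⟩
    refine Quotient.sound ?_
    change MvN (MatProj.add p _).2.1 p.2.1
    exact MvN.trans (MatProj.add _ _).2.2 p.2.2
      (MvN.trans (MatProj.add _ _).2.2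
        (isStarProjection_blockSum (IsStarProjection.zero _) p.2.2) (MatProj.mvn_add p _).symm
        (MvN.blockSum_comm p.2.2 (IsStarProjection.zero _)))
      (MvN.blockSum_empty (IsStarProjection.zero _) p.2.2)

variable (R) in
/-- `K₀` of a unital algebra. -/
abbrev UnitalK0 : Type _ := Algebra.GrothendieckAddGroup (ProjMonoid R)

end Unital

section Functoriality

variable {R S : Type*} [Ring R] [StarRing R] [Algebra ℂ R] [Ring S] [StarRing S] [Algebra ℂ S]

theorem MvN.map {m n : Type*} [Fintype m] [Fintype n] (φ : R →⋆ₐ[ℂ] S) {p : Matrix m m R}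
    {q : Matrix n n R} (h : MvN p q) : MvN (p.map φ) (q.map φ) := by
  obtain ⟨v, h1, h2⟩ := h
  refine ⟨v.map φ, ?_, ?_⟩
  · rw [← Matrix.conjTranspose_map φ (fun x => map_star φ x), ← Matrix.map_mul, h1]
  · rw [← Matrix.conjTranspose_map φ (fun x => map_star φ x), ← Matrix.map_mul, h2]

theorem blockSum_map {m n : Type*} (φ : R →⋆ₐ[ℂ] S) (p : Matrix m m R) (q : Matrix n n R) :
    (blockSum p q).map φ = blockSum (p.map φ) (q.map φ) := by
  simp [blockSum, Matrix.fromBlocks_map]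

/-- The image of a projection over `R` under a unital `*`-homomorphism, applied entrywise. -/
def MatProj.map (φ : R →⋆ₐ[ℂ] S) (p : MatProj R) : MatProj S :=
  ⟨p.1, p.2.1.map φ, by
    have h1 : (p.2.1)ᴴ = p.2.1 := p.2.2.isSelfAdjoint
    have h2 : p.2.1 * p.2.1 = p.2.1 := p.2.2.isIdempotentElem
    constructor
    · change _ * _ = _
      rw [← Matrix.map_mul, h2]
    · change (p.2.1.map φ)ᴴ = _
      rw [← Matrix.conjTranspose_map φ (fun x => map_star φ x), h1]⟩

/-- The map of monoids of projections induced by a unital `*`-homomorphism. -/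
def ProjMonoid.map (φ : R →⋆ₐ[ℂ] S) : ProjMonoid R →+ ProjMonoid S where
  toFun := Quotient.map (MatProj.map φ) fun _ _ h => MvN.map φ h
  map_zero' := by
    refine Quotient.sound ?_
    refine ⟨0, ?_, ?_⟩
    · ext i; exact i.elim0
    · ext i; exact i.elim0
  map_add' := by
    rintro ⟨p⟩ ⟨q⟩
    have e : MatProj.map φ (p.add q) = (p.map φ).add (q.map φ) := by
      refine Sigma.ext rfl (heq_of_eq (Subtype.ext ?_))
      change ((blockSum p.2.1 q.2.1).submatrix _ _).map φ
        = (blockSum (p.2.1.map φ) (q.2.1.map φ)).submatrix _ _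
      rw [← blockSum_map]
      rfl
    exact congrArg ProjMonoid.mk e

/-- The homomorphism `K₀(R) → K₀(S)` induced by a unital `*`-homomorphism. -/
def UnitalK0.map (φ : R →⋆ₐ[ℂ] S) : UnitalK0 R →+ UnitalK0 S :=
  Algebra.GrothendieckAddGroup.lift
    ((Algebra.GrothendieckAddGroup.of (M := ProjMonoid S)).comp (ProjMonoid.map φ))

end Functoriality

section NonUnital

variable (A : Type*) [NonUnitalRing A] [StarRing A] [Module ℂ A] [IsScalarTower ℂ A A]
  [SMulCommClass ℂ A A] [StarModule ℂ A]

/-- The augmentation `A⁺ → ℂ`, `(c, a) ↦ c`, with kernel `A`. -/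
def augmentation : Unitization ℂ A →⋆ₐ[ℂ] ℂ where
  __ := Unitization.fstHom ℂ A
  map_star' := fun _ => rfl

/-- `K₀(A) = ker (K₀(A⁺) → K₀(ℂ))`. -/
def K0 : AddSubgroup (UnitalK0 (Unitization ℂ A)) := (UnitalK0.map (augmentation A)).ker

variable {A}

/-- A projection `p ∈ A`, as a `1 × 1` matrix over the unitization of `A`. -/
def projMat (p : A) (hp : IsStarProjection p) : MatProj (Unitization ℂ A) :=
  ⟨1, Matrix.of fun _ _ => (p : Unitization ℂ A), by
    have h1 : star p = p := hp.isSelfAdjoint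
    have h2 : p * p = p := hp.isIdempotentElem
    constructor
    · change _ * _ = _
      refine Matrix.ext fun i j => ?_
      simp [Matrix.mul_apply, ← Unitization.inr_mul, h2]
    · change Matrix.conjTranspose _ = _
      refine Matrix.ext fun i j => ?_
      simp [← Unitization.inr_star, h1]⟩

/-- The class `[p] ∈ K₀(A)` of a projection `p ∈ A`. -/
def K0.mk (p : A) (hp : IsStarProjection p) : K0 A :=
  ⟨Algebra.GrothendieckAddGroup.of (ProjMonoid.mk (projMat p hp)), by
    have e : ProjMonoid.map (augmentation A) (ProjMonoid.mk (projMat p hp)) = 0 := by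
      refine Quotient.sound ?_
      refine ⟨0, ?_, ?_⟩
      · ext i j
        change (∑ k : Fin 0, (0 : Matrix (Fin 1) (Fin 0) ℂ) i k * (0 : Matrix (Fin 0) (Fin 1) ℂ) k j)
          = (p : Unitization ℂ A).fst
        simp
      · ext i; exact i.elim0
    change UnitalK0.map (augmentation A) _ = 0
    have h : UnitalK0.map (augmentation A)
        (Algebra.GrothendieckAddGroup.of (ProjMonoid.mk (projMat p hp)))
        = Algebra.GrothendieckAddGroup.of
          (ProjMonoid.map (augmentation A) (ProjMonoid.mk (projMat p hp))) := by
      have := Algebra.GrothendieckAddGroup.lift.symm_apply_apply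
        ((Algebra.GrothendieckAddGroup.of (M := ProjMonoid ℂ)).comp
          (ProjMonoid.map (augmentation A)))
      exact DFunLike.congr_fun this (ProjMonoid.mk (projMat p hp))
    rw [h, e, map_zero]⟩

end NonUnital

end KTheory

/-! ## The Roe algebra -/

namespace RoeAlgebra

variable {X : Type*} [MetricSpace X] [MeasurableSpace X] [BorelSpace X]

/-- `L²(X, m)`, complex valued. -/
abbrev L2 (m : Measure X) : Type _ := Lp ℂ 2 m

theorem memLp_top (m : Measure X) (f : C₀(X, ℂ)) : MemLp f ∞ m :=
  memLp_top_of_bound f.continuous.aestronglyMeasurable ‖f.toBCF‖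
    (Filter.Eventually.of_forall fun x => f.toBCF.norm_coe_le_norm x)

/-- The action of `C₀(X)` on `L²(X)` by multiplication. -/
def mulOp (m : Measure X) (f : C₀(X, ℂ)) : L2 m →L[ℂ] L2 m :=
  (ContinuousLinearMap.mul ℂ ℂ).holderL m ∞ 2 2 ((memLp_top m f).toLp f)

theorem mulOp_coeFn (m : Measure X) (f : C₀(X, ℂ)) (ξ : L2 m) :
    mulOp m f ξ =ᵐ[m] fun x => f x * ξ x := by
  have h : mulOp m f ξ
      = (ContinuousLinearMap.mul ℂ ℂ).holder 2 ((memLp_top m f).toLp f) ξ := rfl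
  rw [h]
  filter_upwards [(ContinuousLinearMap.mul ℂ ℂ).coeFn_holder (r := 2) ((memLp_top m f).toLp f) ξ,
    (memLp_top m f).coeFn_toLp] with x hx hx'
  rw [hx, hx']
  rfl

/-- `L²(X)` is ample: no non-zero operator of multiplication by a function in `C₀(X)` is compact.
This is implied both by the absence of atoms of `m` and by the condition that `f` acts by a compact
operator only if `f = 0`. -/
def IsAmple (m : Measure X) : Prop :=
  ∀ f : C₀(X, ℂ), IsCompactOperator (mulOp m f) → mulOp m f = 0

/-- Local compactness: `T f` and `f T` are compact for all `f ∈ C₀(X)`. -/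
def IsLocallyCompactOp (m : Measure X) (T : L2 m →L[ℂ] L2 m) : Prop :=
  ∀ f : C₀(X, ℂ), IsCompactOperator (T ∘L mulOp m f) ∧ IsCompactOperator (mulOp m f ∘L T)

/-- Finite propagation: for some `R > 0`, `f T g = 0` whenever `f, g ∈ C₀(X)` have supports at
distance greater than `R`. -/
def HasFinitePropagation (m : Measure X) (T : L2 m →L[ℂ] L2 m) : Prop :=
  ∃ R : ℝ, 0 < R ∧ ∀ f g : C₀(X, ℂ),
    (∀ x ∈ tsupport f, ∀ y ∈ tsupport g, R < dist x y) → mulOp m f ∘L T ∘L mulOp m g = 0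

/-- The Roe algebra of `X` acting on `L²(X)`: the norm closure of the `*`-algebra of locally
compact operators of finite propagation. These operators form a `*`-algebra, so the
`*`-algebra that they generate consists of these operators only. -/
def roeAlgebra (m : Measure X) : NonUnitalStarSubalgebra ℂ (L2 m →L[ℂ] L2 m) :=
  (NonUnitalStarAlgebra.adjoin ℂ
    {T : L2 m →L[ℂ] L2 m |
      IsLocallyCompactOp m T ∧ HasFinitePropagation m T}).topologicalClosure

end RoeAlgebra

/-! ## Wannier projections -/

namespace Wannier

open RoeAlgebra

variable {X : Type*} [MetricSpace X]

/-- Bounded geometry: there is `r > 0` such that for every `R > 0` the balls of radius `R` are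
covered by a uniformly bounded number of balls of radius `r`. -/
def HasBoundedGeometry (X : Type*) [MetricSpace X] : Prop :=
  ∃ r : ℝ, 0 < r ∧ ∀ R : ℝ, 0 < R → ∃ N : ℕ, ∀ x : X, ∃ S : Finset X,
    S.card ≤ N ∧ Metric.closedBall x R ⊆ ⋃ y ∈ S, Metric.closedBall y r

/-- `D` is uniformly discrete: distinct points of `D` are at distance bounded below. -/
def UniformlyDiscrete (D : Set X) : Prop :=
  ∃ ε : ℝ, 0 < ε ∧ ∀ x ∈ D, ∀ y ∈ D, x ≠ y → ε ≤ dist x y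

/-- The inclusion of the subset `D` into `X` is a coarse equivalence. -/
def CoarselyDense (D : Set X) : Prop :=
  ∃ C : ℝ, 0 < C ∧ ∀ x : X, ∃ y ∈ D, dist x y < C

variable [MeasurableSpace X] [BorelSpace X]

/-- The (essential, closed) support of a function in `L²(X)`: the complement of the largest open
set on which the function vanishes almost everywhere. -/
def essSupport {m : Measure X} (ξ : L2 m) : Set X :=
  {x | ∀ U : Set X, IsOpen U → x ∈ U → ¬ ∀ᵐ y ∂m, y ∈ U → ξ y = 0}

/-- A `D`-compactly supported Wannier basis: functions `φ x` in `L²(X)`, `x ∈ D`, of norm one,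
with disjoint supports of uniformly bounded diameters, such that `x ∈ supp (φ x)`. -/
structure IsWannierBasis {m : Measure X} (D : Set X) (φ : D → L2 m) : Prop where
  disjoint : ∀ x y : D, x ≠ y → Disjoint (essSupport (φ x)) (essSupport (φ y))
  mem : ∀ x : D, (x : X) ∈ essSupport (φ x)
  bounded : ∃ C : ℝ, ∀ x : D, ∀ y ∈ essSupport (φ x), ∀ z ∈ essSupport (φ x), dist y z ≤ C
  norm_eq_one : ∀ x : D, ‖φ x‖ = 1

/-- The orthogonal projection onto the closed linear span of the functions `φ x`. -/
def proj {m : Measure X} {D : Set X} (φ : D → L2 m) : L2 m →L[ℂ] L2 m :=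
  (Submodule.span ℂ (Set.range φ)).topologicalClosure.starProjection

end Wannier

end

/-!
The projection `p` onto the span of the `φ x` is absorbed by an Eilenberg swindle. The points of
`D` form a connected, locally finite, infinite graph in which neighbours are at bounded distance;
moving along infinite branches of its geodesics gives a map `f : D → D` of bounded displacement
for which `(x, n) ↦ f^[n] x` is finite-to-one. Since `L²(X)` is ample, there are orthonormal
functions `u (x, n)` supported near `f^[n] x`. As `f^[0] x = x` and `f` has bounded displacement,
the partial isometries `v : φ x ↦ u (x, 0)` and `w : u (x, n) ↦ u (x, n + 1)` lie in the Roe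
algebra. With `q` the projection onto the span of the `u (x, n)`, one has `v* v = p`, `w* w = q`
and `v v* + w w* = q`, so `p ⊕ q` is equivalent to `q`, whence `[p] = 0`.
-/

section Descendants

variable {V : Type*} {G : SimpleGraph V} {o u v w : V}

/-- The vertices `w` of a graph such that `v` lies on a geodesic from the root `o` to `w`. -/
def descendants (G : SimpleGraph V) (o v : V) : Set V :=
  {w | G.dist o w = G.dist o v + G.dist v w}

theorem descendants_root : descendants G o o = Set.univ :=
  Set.eq_univ_of_forall fun w => by simp [descendants]

theorem self_mem_descendants : v ∈ descendants G o v := by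
  simp [descendants]

theorem exists_adj_dist_add_one (hG : G.Connected) (hvw : v ≠ w) :
    ∃ u, G.Adj v u ∧ G.dist v w = G.dist u w + 1 := by
  obtain ⟨p, hp⟩ := hG.exists_walk_length_eq_dist v w
  cases p with
  | nil => exact absurd rfl hvw
  | @cons _ u _ hadj p =>
    have hle : G.dist u w ≤ p.length := SimpleGraph.dist_le p
    have htriangle : G.dist v w ≤ G.dist v u + G.dist u w := hG.dist_triangle
    rw [SimpleGraph.dist_eq_one_iff_adj.2 hadj] at htriangle
    rw [SimpleGraph.Walk.length_cons] at hp
    exact ⟨u, hadj, by omega⟩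

theorem exists_adj_mem_descendants (hG : G.Connected) (hw : w ∈ descendants G o v)
    (hvw : v ≠ w) :
    ∃ u, G.Adj v u ∧ G.dist o u = G.dist o v + 1 ∧ w ∈ descendants G o u := by
  obtain ⟨u, hadj, hdist⟩ := exists_adj_dist_add_one hG hvw
  have hou : G.dist o u ≤ G.dist o v + G.dist v u := hG.dist_triangle
  have how : G.dist o w ≤ G.dist o u + G.dist u w := hG.dist_triangle
  rw [SimpleGraph.dist_eq_one_iff_adj.2 hadj] at hou
  simp only [descendants, Set.mem_ofPred_eq] at hw ⊢
  exact ⟨u, hadj, by omega, by omega⟩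

theorem exists_adj_infinite_descendants (hG : G.Connected) (hfin : (G.neighborSet v).Finite)
    (hv : (descendants G o v).Infinite) :
    ∃ u, G.Adj v u ∧ G.dist o u = G.dist o v + 1 ∧ (descendants G o u).Infinite := by
  by_contra! hcon
  refine hv (((Set.finite_singleton v).union ((hfin.inter_of_left
    {u | G.dist o u = G.dist o v + 1}).biUnion fun u hu =>
      (hcon u hu.1 hu.2))).subset fun w hw => ?_)
  by_cases hvw : v = w
  · exact Or.inl hvw.symm
  · obtain ⟨u, hadj, hdist, hwu⟩ := exists_adj_mem_descendants hG hw hvw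
    exact Or.inr (Set.mem_biUnion (x := u) ⟨hadj, hdist⟩ hwu)

theorem exists_adj_descendants_ssubset (hG : G.Connected) (hv : v ≠ o) :
    ∃ u, G.Adj v u ∧ descendants G o v ⊂ descendants G o u := by
  obtain ⟨u, hadj, hdist⟩ := exists_adj_dist_add_one hG hv
  have hvu : G.dist v u = 1 := SimpleGraph.dist_eq_one_iff_adj.2 hadj
  rw [SimpleGraph.dist_comm (u := v), SimpleGraph.dist_comm (u := u)] at hdist
  refine ⟨u, hadj, fun w hw => ?_, fun hsub => ?_⟩
  · have huw : G.dist u w ≤ G.dist u v + G.dist v w := hG.dist_triangle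
    have how : G.dist o w ≤ G.dist o u + G.dist u w := hG.dist_triangle
    rw [SimpleGraph.dist_comm (u := u) (v := v), hvu] at huw
    simp only [descendants, Set.mem_ofPred_eq] at hw ⊢
    omega
  · have huv : u ∈ descendants G o v := hsub self_mem_descendants
    simp only [descendants, Set.mem_ofPred_eq] at huv
    omega

end Descendants

section Iterates

variable {V : Type*}

open Filter

theorem tendsto_iterate_cofinite_of_lt {α : Type*} [LT α] [WellFoundedLT α] {f : V → V}
    (hf : ∀ y, (f ⁻¹' {y}).Finite) (ρ : V → α) (hρ : ∀ v, ρ v < ρ (f v)) :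
    Tendsto (fun t : V × ℕ => f^[t.2] t.1) cofinite cofinite := by
  refine Tendsto.cofinite_of_finite_preimage_singleton fun y => ?_
  induction y using (InvImage.wf ρ wellFounded_lt).induction with
  | _ y ih =>
    refine ((Set.finite_singleton (y, 0)).union ((hf y).biUnion fun z hz =>
      Set.Finite.image (Prod.map id Nat.succ) (ih z ?_))).subset ?_
    · exact (hρ z).trans_eq (congrArg ρ hz)
    rintro ⟨x, _ | n⟩ hx
    · exact Or.inl (Prod.ext hx rfl)
    · refine Or.inr (Set.mem_biUnion (x := f^[n] x) ?_ ⟨(x, n), rfl, rfl⟩)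
      rwa [Set.mem_preimage, Set.mem_singleton_iff, Function.iterate_succ_apply'] at hx

theorem exists_adj_tendsto_iterate_cofinite {G : SimpleGraph V} [Infinite V] (hG : G.Connected)
    (hfin : ∀ v, (G.neighborSet v).Finite) :
    ∃ f : V → V, (∀ v, G.Adj v (f v)) ∧
      Tendsto (fun t : V × ℕ => f^[t.2] t.1) cofinite cofinite := by
  classical
  obtain ⟨o⟩ := hG.nonempty
  have hroot : (descendants G o o).Infinite := descendants_root ▸ Set.infinite_univ
  have hstep (v : V) : ∃ u, G.Adj v u ∧ if (descendants G o v).Infinite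
      then G.dist o u = G.dist o v + 1 ∧ (descendants G o u).Infinite
      else descendants G o v ⊂ descendants G o u := by
    split_ifs with hv
    · exact exists_adj_infinite_descendants hG (hfin v) hv
    · exact exists_adj_descendants_ssubset hG fun h => hv (h ▸ hroot)
  choose f hadj hf using hstep
  have hfibre (u : V) : (f ⁻¹' {u}).Finite :=
    (hfin u).subset fun v hv => (Eq.subst hv (hadj v) : G.Adj v u).symm
  -- `f` steps to a child with infinitely many descendants when there is one, and otherwise towards
  -- the root, so the depth, respectively the number of descendants, increases along `f`.
  let ρ (v : V) : ℕ ×ₗ ℕ := if (descendants G o v).Infinite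
    then toLex (1, G.dist o v) else toLex (0, (descendants G o v).ncard)
  refine ⟨f, hadj, tendsto_iterate_cofinite_of_lt hfibre ρ fun v => ?_⟩
  specialize hf v
  by_cases hv : (descendants G o v).Infinite
  · rw [if_pos hv] at hf
    simp [ρ, hv, hf.1, hf.2, Prod.Lex.toLex_lt_toLex]
  · rw [if_neg hv] at hf
    by_cases hfv : (descendants G o (f v)).Infinite
    · simp [ρ, hv, hfv, Prod.Lex.toLex_lt_toLex]
    · have := Set.ncard_lt_ncard hf (Set.not_infinite.1 hfv)
      simp [ρ, hv, hfv, Prod.Lex.toLex_lt_toLex, this]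

end Iterates

section LocallyFinite

open Filter

variable {X T : Type*} [PseudoMetricSpace X] {c : T → X}

theorem finite_preimage_of_isBounded (hc : Tendsto c cofinite (Bornology.cobounded X)) {s : Set X}
    (hs : Bornology.IsBounded s) : (c ⁻¹' s).Finite := by
  simpa using hc (Bornology.isBounded_def.1 hs)

theorem countable_of_tendsto_cobounded (hc : Tendsto c cofinite (Bornology.cobounded X)) :
    Countable T := by
  rcases isEmpty_or_nonempty T with _ | ⟨⟨t⟩⟩
  · infer_instance
  · refine Set.countable_univ_iff.1 ((Set.countable_iUnion fun n : ℕ =>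
      (finite_preimage_of_isBounded hc (Metric.isBounded_closedBall
        (x := c t) (r := n))).countable).mono fun s _ => ?_)
    exact Set.mem_iUnion.2 (exists_nat_ge (dist (c s) (c t)))

end LocallyFinite

namespace Wannier

open Filter

variable {X : Type*} [MetricSpace X] {D : Set X}

theorem UniformlyDiscrete.tendsto_cobounded [ProperSpace X] (hD : UniformlyDiscrete D) :
    Tendsto ((↑) : D → X) cofinite (Bornology.cobounded X) := by
  obtain ⟨ε, hε, hsep⟩ := hD
  have hpair : Pairwise fun x y : D => ε ≤ dist (x : X) y :=
    fun x y hxy => hsep x x.2 y y.2 (Subtype.coe_injective.ne hxy)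
  have : DiscreteTopology D := DiscreteTopology.of_forall_le_dist hε hpair
  rw [Metric.cobounded_eq_cocompact]
  exact tendsto_cofinite_cocompact_of_discrete
    (Metric.isClosedEmbedding_of_pairwise_le_dist hε hpair).tendsto_cocompact

theorem CoarselyDense.infinite [ProperSpace X] [NoncompactSpace X] (hD : CoarselyDense D) :
    D.Infinite := by
  obtain ⟨C, hC⟩ := hD
  intro hfin
  refine noncompact_univ X (Metric.isCompact_of_isClosed_isBounded isClosed_univ
    (hfin.isBounded.thickening.subset (t := Metric.thickening C D) fun x _ => ?_))
  exact Metric.mem_thickening_iff.2 (hC.2 x)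

/-- The graph on `D` in which two points are adjacent when their distance is less than `K`; for
`K` large enough it is a connected discrete model of a connected space in which `D` is dense at a
bounded scale. -/
def proximityGraph (D : Set X) (K : ℝ) : SimpleGraph D where
  Adj x y := x ≠ y ∧ dist (x : X) y < K
  symm := ⟨fun x y h => ⟨h.1.symm, by rw [dist_comm]; exact h.2⟩⟩
  loopless := ⟨fun _ h => h.1 rfl⟩

theorem CoarselyDense.exists_preconnected_proximityGraph [PreconnectedSpace X]
    (hD : CoarselyDense D) : ∃ K, (proximityGraph D K).Preconnected := by
  obtain ⟨C, hC, hdense⟩ := hD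
  let P (x y : X) : Prop := ∀ a b : D, dist x a < C → dist y b < C →
    (proximityGraph D (3 * C)).Reachable a b
  have hsymm : Std.Symm P := ⟨fun x y h a b ha hb => (h b a hb ha).symm⟩
  have htrans : IsTrans X P := ⟨fun x y z hxy hyz a b ha hb =>
    let ⟨d, hd, hyd⟩ := hdense y
    (hxy a ⟨d, hd⟩ ha hyd).trans (hyz ⟨d, hd⟩ b hyd hb)⟩
  have hlocal (x : X) : ∀ᶠ y in 𝓝 x, P x y := by
    filter_upwards [Metric.ball_mem_nhds x hC] with y hy a b ha hb
    by_cases hab : a = b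
    · exact hab ▸ SimpleGraph.Reachable.refl a
    · refine SimpleGraph.Adj.reachable ⟨hab, ?_⟩
      have := dist_triangle4 (a : X) x y b
      rw [dist_comm] at ha
      linarith [Metric.mem_ball'.1 hy]
  exact ⟨3 * C, fun a b => PreconnectedSpace.induction₂ P hlocal htrans a b a b
    (by rwa [dist_self]) (by rwa [dist_self])⟩

theorem CoarselyDense.exists_tendsto_iterate [ProperSpace X] [PreconnectedSpace X]
    [NoncompactSpace X] (hDX : CoarselyDense D)
    (hD : Tendsto ((↑) : D → X) cofinite (Bornology.cobounded X)) :
    ∃ (K : ℝ) (f : D → D), (∀ x : D, dist (x : X) (f x) ≤ K) ∧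
      Tendsto (fun t : D × ℕ => f^[t.2] t.1) cofinite cofinite := by
  have : Infinite D := hDX.infinite.to_subtype
  obtain ⟨K, hK⟩ := hDX.exists_preconnected_proximityGraph
  obtain ⟨f, hadj, hf⟩ := exists_adj_tendsto_iterate_cofinite (G := proximityGraph D K) ⟨hK⟩
    fun x => (finite_preimage_of_isBounded hD Metric.isBounded_ball).subset
      fun y hy => Metric.mem_ball'.2 hy.2
  exact ⟨K, f, fun x => (hadj x).2.le, hf⟩

end Wannier

section PartialIsometry

open Submodule Filter

variable {𝕜 T H : Type*} [RCLike 𝕜] [NormedAddCommGroup H] [InnerProductSpace 𝕜 H]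
  [CompleteSpace H] {ψ ψ' ψ'' : T → H}

/-- The isometry `ℓ²(T) → H` taking the standard basis to the orthonormal family `ψ`. -/
noncomputable def synthesis (h : Orthonormal 𝕜 ψ) : lp (fun _ : T => 𝕜) 2 →L[𝕜] H :=
  h.orthogonalFamily.linearIsometry.toContinuousLinearMap

theorem hasSum_synthesis (h : Orthonormal 𝕜 ψ) (a : lp (fun _ : T => 𝕜) 2) :
    HasSum (fun t => a t • ψ t) (synthesis h a) :=
  h.orthogonalFamily.hasSum_linearIsometry a

theorem synthesis_single [DecidableEq T] (h : Orthonormal 𝕜 ψ) (t : T) :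
    synthesis h (lp.single 2 t 1) = ψ t :=
  (h.orthogonalFamily.linearIsometry_apply_single (1 : 𝕜)).trans (one_smul 𝕜 (ψ t))

theorem adjoint_synthesis_comp_synthesis (h : Orthonormal 𝕜 ψ) :
    (synthesis h).adjoint ∘L synthesis h = 1 :=
  (ContinuousLinearMap.norm_map_iff_adjoint_comp_self _).1
    h.orthogonalFamily.linearIsometry.norm_map

theorem adjoint_synthesis_apply (h : Orthonormal 𝕜 ψ) (x : H) (t : T) :
    (synthesis h).adjoint x t = inner 𝕜 (ψ t) x := by
  classical
  rw [← synthesis_single h t, ← ContinuousLinearMap.adjoint_inner_right, lp.inner_single_left,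
    RCLike.inner_apply, map_one, mul_one]

/-- The partial isometry taking the orthonormal family `ψ` to the orthonormal family `ψ'` and
vanishing on the orthogonal complement of `ψ`. -/
noncomputable def partialIsometry (h : Orthonormal 𝕜 ψ) (h' : Orthonormal 𝕜 ψ') : H →L[𝕜] H :=
  synthesis h' ∘L (synthesis h).adjoint

theorem hasSum_partialIsometry (h : Orthonormal 𝕜 ψ) (h' : Orthonormal 𝕜 ψ') (x : H) :
    HasSum (fun t => inner 𝕜 (ψ t) x • ψ' t) (partialIsometry h h' x) := by
  have hsum := hasSum_synthesis h' ((synthesis h).adjoint x)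
  simp only [adjoint_synthesis_apply] at hsum
  exact hsum

theorem inner_partialIsometry_apply (h : Orthonormal 𝕜 ψ) (h' : Orthonormal 𝕜 ψ') (x : H) (t : T) :
    inner 𝕜 (ψ' t) (partialIsometry h h' x) = inner 𝕜 (ψ t) x := by
  rw [← adjoint_synthesis_apply h', ← adjoint_synthesis_apply h]
  exact congrArg (· t)
    (DFunLike.congr_fun (adjoint_synthesis_comp_synthesis h') ((synthesis h).adjoint x))

theorem star_partialIsometry (h : Orthonormal 𝕜 ψ) (h' : Orthonormal 𝕜 ψ') :
    star (partialIsometry h h') = partialIsometry h' h := by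
  rw [ContinuousLinearMap.star_eq_adjoint, partialIsometry, ContinuousLinearMap.adjoint_comp,
    ContinuousLinearMap.adjoint_adjoint, partialIsometry]

theorem partialIsometry_mul_partialIsometry (h : Orthonormal 𝕜 ψ) (h' : Orthonormal 𝕜 ψ')
    (h'' : Orthonormal 𝕜 ψ'') :
    partialIsometry h' h'' * partialIsometry h h' = partialIsometry h h'' := by
  ext x
  exact congrArg (synthesis h'')
    (DFunLike.congr_fun (adjoint_synthesis_comp_synthesis h') ((synthesis h).adjoint x))

theorem star_partialIsometry_mul_self (h : Orthonormal 𝕜 ψ) (h' : Orthonormal 𝕜 ψ') :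
    star (partialIsometry h h') * partialIsometry h h' = partialIsometry h h := by
  rw [star_partialIsometry, partialIsometry_mul_partialIsometry]

theorem isStarProjection_partialIsometry_self (h : Orthonormal 𝕜 ψ) :
    IsStarProjection (partialIsometry h h) :=
  ⟨partialIsometry_mul_partialIsometry h h h, star_partialIsometry h h⟩

theorem partialIsometry_mul_partialIsometry_eq_zero {T' : Type*} {χ χ' : T' → H}
    (h : Orthonormal 𝕜 ψ) (h' : Orthonormal 𝕜 ψ') (k : Orthonormal 𝕜 χ) (k' : Orthonormal 𝕜 χ')
    (hort : ∀ t s, inner 𝕜 (ψ t) (χ' s) = 0) :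
    partialIsometry h h' * partialIsometry k k' = 0 := by
  ext x
  have hcoeff (t : T) : inner 𝕜 (ψ t) (partialIsometry k k' x) = 0 := by
    have hsum := (hasSum_partialIsometry k k' x).mapL (innerSL 𝕜 (ψ t))
    simp only [innerSL_apply_apply, inner_smul_right, hort, mul_zero] at hsum
    exact hsum.unique hasSum_zero
  have hsum := hasSum_partialIsometry h h' (partialIsometry k k' x)
  simp only [hcoeff, zero_smul] at hsum
  exact hsum.unique hasSum_zero

theorem partialIsometry_self_eq_starProjection (h : Orthonormal 𝕜 ψ) :
    partialIsometry h h = (span 𝕜 (Set.range ψ)).topologicalClosure.starProjection := by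
  ext x
  refine (eq_starProjection_of_mem_orthogonal ?_ ?_).symm
  · exact mem_closure_of_tendsto (hasSum_partialIsometry h h x) (Eventually.of_forall fun s =>
      sum_mem fun t _ => smul_mem _ _ (subset_span ⟨t, rfl⟩))
  · rw [orthogonal_closure]
    have hortho : span 𝕜 {x - partialIsometry h h x} ⟂ span 𝕜 (Set.range ψ) := by
      refine (isOrtho_span.2 ?_).symm
      rintro _ ⟨t, rfl⟩ _ rfl
      rw [inner_sub_right, inner_partialIsometry_apply, sub_self]
    exact hortho (mem_span_singleton_self _)

theorem partialIsometry_add_of_isCompl {T₁ T₂ : Type*} {i₁ : T₁ → T} {i₂ : T₂ → T}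
    (h : Orthonormal 𝕜 ψ) (h' : Orthonormal 𝕜 ψ') (hi₁ : i₁.Injective) (hi₂ : i₂.Injective)
    (hi : IsCompl (Set.range i₁) (Set.range i₂)) :
    partialIsometry (h.comp i₁ hi₁) (h'.comp i₁ hi₁)
      + partialIsometry (h.comp i₂ hi₂) (h'.comp i₂ hi₂) = partialIsometry h h' := by
  ext x
  let f (t : T) : H := inner 𝕜 (ψ t) x • ψ' t
  exact HasSum.unique (HasSum.add_isCompl (f := f) hi
    (hi₁.hasSum_range_iff.2 (hasSum_partialIsometry (h.comp i₁ hi₁) (h'.comp i₁ hi₁) x))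
    (hi₂.hasSum_range_iff.2 (hasSum_partialIsometry (h.comp i₂ hi₂) (h'.comp i₂ hi₂) x)))
    (hasSum_partialIsometry h h' x)

end PartialIsometry

section CompactOperators

variable {𝕜 E F : Type*}

theorem exists_orthonormal_nat [RCLike 𝕜] [NormedAddCommGroup E] [InnerProductSpace 𝕜 E]
    {K : Submodule 𝕜 E} (hK : ¬ FiniteDimensional 𝕜 K) :
    ∃ e : ℕ → E, Orthonormal 𝕜 e ∧ ∀ n, e n ∈ K := by
  let b := Module.Basis.ofVectorSpace 𝕜 K
  have hinf : Infinite (Module.Basis.ofVectorSpaceIndex 𝕜 K) :=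
    not_finite_iff_infinite.1 fun _ => hK (Module.Finite.of_basis b)
  have hli := b.linearIndependent.comp _ (Infinite.natEmbedding _).injective
  exact ⟨_, (InnerProductSpace.gramSchmidtNormed_orthonormal hli).comp_linearIsometry
    K.subtypeₗᵢ, fun n => Subtype.mem _⟩

variable [NontriviallyNormedField 𝕜] [LocallyCompactSpace 𝕜] [CompleteSpace 𝕜]
  [NormedAddCommGroup E] [NormedSpace 𝕜 E] [NormedAddCommGroup F] [NormedSpace 𝕜 F]

theorem isCompactOperator_of_range_le {A : E →L[𝕜] F} {V : Submodule 𝕜 F}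
    [FiniteDimensional 𝕜 V] (hA : ∀ x, A x ∈ V) : IsCompactOperator A := by
  have hV : IsCompactOperator (id : V → V) := isCompactOperator_id_iff_finiteDimensional.2 ‹_›
  exact (hV.comp_clm (A.codRestrict V hA)).clm_comp V.subtypeL

theorem isCompactOperator_of_hasSum {T : Type*} {A : E →L[𝕜] F} {a : E → T → 𝕜} {y : T → F}
    (hA : ∀ x, HasSum (fun t => a x t • y t) (A x))
    (hfin : {t | ∃ x, a x t • y t ≠ 0}.Finite) : IsCompactOperator A := by
  let V := Submodule.span 𝕜 (y '' {t | ∃ x, a x t • y t ≠ 0})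
  have : FiniteDimensional 𝕜 V := FiniteDimensional.span_of_finite 𝕜 (hfin.image y)
  refine isCompactOperator_of_range_le (V := V) fun x => ?_
  rw [(hA x).unique (hasSum_sum_of_ne_finset_zero (s := hfin.toFinset) fun t ht => ?_)]
  · exact sum_mem fun t ht => Submodule.smul_mem _ _
      (Submodule.subset_span (Set.mem_image_of_mem y (hfin.mem_toFinset.1 ht)))
  · by_contra hne
    exact ht (hfin.mem_toFinset.2 ⟨x, hne⟩)

end CompactOperators

namespace KTheory

section Swindle

variable {A : Type*} [NonUnitalRing A] [StarRing A] [Module ℂ A] [IsScalarTower ℂ A A]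
  [SMulCommClass ℂ A A] [StarModule ℂ A] {p q v w : A}

theorem mvn_blockSum_of_row (hv : star v * v = p) (hw : star w * w = q) (hvw : star v * w = 0)
    (hsum : v * star v + w * star w = q) :
    MvN (m := Fin 1 ⊕ Fin 1) (n := Fin 1) (R := Unitization ℂ A)
      (blockSum (Matrix.of fun _ _ => (p : Unitization ℂ A))
        (Matrix.of fun _ _ => (q : Unitization ℂ A)))
      (Matrix.of fun _ _ => (q : Unitization ℂ A)) := by
  have hwv : star w * v = 0 := by simpa using congrArg star hvw
  refine ⟨Matrix.of fun _ => Sum.elim (fun _ => (v : Unitization ℂ A)) (fun _ => w), ?_, ?_⟩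
  · ext1 (i | i) (j | j) <;>
      simp [Matrix.mul_apply, blockSum, ← Unitization.inr_star, ← Unitization.inr_mul, hv, hw,
        hvw, hwv]
  · ext1 i j
    simp [Matrix.mul_apply, ← Unitization.inr_star, ← Unitization.inr_mul,
      ← Unitization.inr_add, hsum]

theorem K0.mk_eq_zero_of_row (hp : IsStarProjection p) (hq : IsStarProjection q)
    (hv : star v * v = p) (hw : star w * w = q) (hvw : star v * w = 0)
    (hsum : v * star v + w * star w = q) : K0.mk p hp = 0 := by
  have hadd : ProjMonoid.mk (projMat p hp) + ProjMonoid.mk (projMat q hq)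
      = ProjMonoid.mk (projMat q hq) :=
    Quotient.sound (MvN.trans (MatProj.add _ _).2.2 (projMat q hq).2.2
      (MatProj.mvn_add _ _).symm (mvn_blockSum_of_row hv hw hvw hsum))
  have hclass := congrArg (Algebra.GrothendieckAddGroup.of (M := ProjMonoid (Unitization ℂ A))) hadd
  rw [map_add, add_eq_right] at hclass
  exact Subtype.ext hclass

end Swindle

theorem K0.mk_partialIsometry_eq_zero {ι T H : Type*} [NormedAddCommGroup H]
    [InnerProductSpace ℂ H] [CompleteSpace H] {S : NonUnitalStarSubalgebra ℂ (H →L[ℂ] H)}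
    {ψ : ι → H} {u : T → H} (hψ : Orthonormal ℂ ψ) (hu : Orthonormal ℂ u)
    {i : ι → T} {j : T → T} (hi : i.Injective) (hj : j.Injective)
    (hij : IsCompl (Set.range i) (Set.range j))
    (hv : partialIsometry hψ (hu.comp i hi) ∈ S) (hw : partialIsometry hu (hu.comp j hj) ∈ S) :
    ∃ (p : S) (hp : IsStarProjection p), (p : H →L[ℂ] H) = partialIsometry hψ hψ ∧
      K0.mk p hp = 0 := by
  let v : S := ⟨_, hv⟩
  let w : S := ⟨_, hw⟩
  have hvv : ((star v * v : S) : H →L[ℂ] H) = partialIsometry hψ hψ :=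
    star_partialIsometry_mul_self _ _
  have hww : ((star w * w : S) : H →L[ℂ] H) = partialIsometry hu hu :=
    star_partialIsometry_mul_self _ _
  have hp : IsStarProjection (star v * v) := by
    have h := isStarProjection_partialIsometry_self hψ
    rw [← hvv] at h
    exact ⟨Subtype.ext h.1, Subtype.ext h.2⟩
  have hq : IsStarProjection (star w * w) := by
    have h := isStarProjection_partialIsometry_self hu
    rw [← hww] at h
    exact ⟨Subtype.ext h.1, Subtype.ext h.2⟩
  have hvw : star v * w = 0 := by
    refine Subtype.ext ?_
    change star (partialIsometry _ _) * partialIsometry _ _ = 0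
    rw [star_partialIsometry]
    exact partialIsometry_mul_partialIsometry_eq_zero _ _ _ _ fun x t =>
      hu.2 fun hxt => Set.disjoint_left.1 hij.disjoint ⟨x, rfl⟩ ⟨t, hxt.symm⟩
  have hsum : v * star v + w * star w = star w * w := by
    refine Subtype.ext (Eq.trans ?_ hww.symm)
    change partialIsometry _ _ * star (partialIsometry _ _)
      + partialIsometry _ _ * star (partialIsometry _ _) = _
    rw [star_partialIsometry, star_partialIsometry, partialIsometry_mul_partialIsometry,
      partialIsometry_mul_partialIsometry, partialIsometry_add_of_isCompl hu hu hi hj hij]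
  exact ⟨_, hp, hvv, K0.mk_eq_zero_of_row hp hq rfl rfl hvw hsum⟩

end KTheory

section CompactSupport

variable {X : Type*} [TopologicalSpace X] [RegularSpace X] [LocallyCompactSpace X]

theorem dense_setOf_hasCompactSupport {E : Type*} [NormedAddCommGroup E] [NormedSpace ℝ E] :
    Dense {g : C₀(X, E) | HasCompactSupport g} := by
  intro f
  refine Metric.mem_closure_iff.2 fun ε hε => ?_
  have hsmall : ∀ᶠ x in Filter.cocompact X, ‖f x‖ < ε / 2 := by
    simpa using (zero_at_infty f).norm.eventually_lt_const (by simpa using half_pos hε)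
  obtain ⟨s, hs, hfs⟩ := Filter.mem_cocompact.1 hsmall
  obtain ⟨k, hk_one, -, hk, hk_mem⟩ := exists_continuous_one_zero_of_isCompact hs isClosed_empty
    (Set.disjoint_empty s)
  have hkf : HasCompactSupport (k • f.toContinuousMap) := hk.smul_right
  refine ⟨⟨k • f.toContinuousMap, hkf.is_zero_at_infty⟩, hkf, ?_⟩
  refine lt_of_le_of_lt ?_ (half_lt_self hε)
  rw [← ZeroAtInftyContinuousMap.dist_toBCF_eq_dist,
    BoundedContinuousFunction.dist_le (half_pos hε).le]
  intro x
  change dist (f x) (k x • f x) ≤ ε / 2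
  by_cases hx : x ∈ s
  · rw [hk_one hx, Pi.one_apply, one_smul, dist_self]
    positivity
  · calc dist (f x) (k x • f x) = (1 - k x) * ‖f x‖ := by
          rw [dist_eq_norm, ← one_smul ℝ (f x), smul_smul, mul_one, ← sub_smul, norm_smul,
            Real.norm_of_nonneg (sub_nonneg.2 (hk_mem x).2), one_smul]
      _ ≤ 1 * ‖f x‖ := by
          gcongr
          linarith [(hk_mem x).1]
      _ ≤ ε / 2 := by
          rw [one_mul]
          exact (hfs hx).le

theorem isCompactOperator_of_forall_hasCompactSupport {E F : Type*} [NormedAddCommGroup E]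
    [NormedSpace ℂ E] [NormedAddCommGroup F] [NormedSpace ℂ F] [CompleteSpace F]
    {Φ : C₀(X, ℂ) → E →L[ℂ] F} (hΦ : Continuous Φ)
    (hcompact : ∀ g : C₀(X, ℂ), HasCompactSupport g → IsCompactOperator (Φ g)) (f : C₀(X, ℂ)) :
    IsCompactOperator (Φ f) :=
  ((isClosed_setOfPred_isCompactOperator (𝕜₁ := ℂ) (σ₁₂ := RingHom.id ℂ)).preimage
    hΦ).closure_subset_iff.2 hcompact (dense_setOf_hasCompactSupport f)

end CompactSupport

namespace RoeAlgebra

open Filter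

theorem inner_eq_zero_of_ae {X : Type*} [MeasurableSpace X] {m : Measure X} {ξ η : L2 m}
    (h : ∀ᵐ x ∂m, ξ x = 0 ∨ η x = 0) : inner ℂ ξ η = 0 := by
  rw [L2.inner_def]
  refine integral_eq_zero_of_ae ?_
  filter_upwards [h] with x hx
  rcases hx with hx | hx <;> simp [hx]

variable {X : Type*} [MetricSpace X] [MeasurableSpace X] {m : Measure X}

/-- An orthonormal family in `L²(X)` which is localized at scale `R` near the centers `c t`: the
function `ψ t` vanishes almost everywhere off the ball of radius `R` around `c t`, and only
finitely many of the centers (counted with multiplicity) lie in any bounded set. -/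
structure IsLocalized {T : Type*} (R : ℝ) (c : T → X) (ψ : T → L2 m) : Prop where
  orthonormal : Orthonormal ℂ ψ
  eq_zero : ∀ t, ∀ᵐ x ∂m, x ∉ Metric.closedBall (c t) R → ψ t x = 0
  tendsto : Tendsto c cofinite (Bornology.cobounded X)

theorem IsLocalized.comp {T T' : Type*} {R : ℝ} {c : T → X} {ψ : T → L2 m}
    (h : IsLocalized R c ψ) {i : T' → T} (hi : i.Injective) :
    IsLocalized R (c ∘ i) (ψ ∘ i) where
  orthonormal := h.orthonormal.comp i hi
  eq_zero t := h.eq_zero (i t)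
  tendsto := h.tendsto.comp hi.tendsto_cofinite

variable [BorelSpace X]

theorem mulOp_eq_zero_iff {f : C₀(X, ℂ)} {ξ : L2 m} :
    mulOp m f ξ = 0 ↔ ∀ᵐ x ∂m, f x = 0 ∨ ξ x = 0 := by
  rw [Lp.eq_zero_iff_ae_eq_zero]
  refine eventually_congr ?_
  filter_upwards [mulOp_coeFn m f ξ] with x hx
  rw [hx, Pi.zero_apply, mul_eq_zero]

theorem inner_mulOp_eq_zero {f : C₀(X, ℂ)} {ξ : L2 m} (h : mulOp m f ξ = 0) (η : L2 m) :
    inner ℂ ξ (mulOp m f η) = 0 := by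
  refine inner_eq_zero_of_ae ?_
  filter_upwards [mulOp_eq_zero_iff.1 h, mulOp_coeFn m f η] with x hx hη
  exact hx.symm.imp_right fun hf => by rw [hη, hf, zero_mul]

theorem continuous_mulOp : Continuous (mulOp m) := by
  refine (LipschitzWith.of_dist_le_mul (K := 1) fun f g => ?_).continuous
  rw [NNReal.coe_one, one_mul, dist_eq_norm]
  refine ContinuousLinearMap.opNorm_le_bound _ dist_nonneg fun ξ => ?_
  refine Lp.norm_le_mul_norm_of_ae_le_mul ?_
  rw [sub_apply]
  filter_upwards [mulOp_coeFn m f ξ, mulOp_coeFn m g ξ,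
    Lp.coeFn_sub (mulOp m f ξ) (mulOp m g ξ)] with x hf hg hfg
  rw [hfg, Pi.sub_apply, hf, hg, ← sub_mul, norm_mul]
  gcongr
  rw [← dist_eq_norm, ← ZeroAtInftyContinuousMap.dist_toBCF_eq_dist]
  exact BoundedContinuousFunction.dist_coe_le_dist (f := f.toBCF) (g := g.toBCF) x

namespace IsLocalized

variable {T : Type*} {R R' : ℝ} {c c' : T → X} {ψ ψ' : T → L2 m}

theorem mulOp_eq_zero (h : IsLocalized R c ψ) {f : C₀(X, ℂ)} {t : T}
    (hf : Disjoint (tsupport f) (Metric.closedBall (c t) R)) : mulOp m f (ψ t) = 0 := by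
  refine mulOp_eq_zero_iff.2 ?_
  filter_upwards [h.eq_zero t] with x hx
  by_cases hxf : x ∈ tsupport f
  · exact Or.inr (hx (Set.disjoint_left.1 hf hxf))
  · exact Or.inl (image_eq_zero_of_notMem_tsupport hxf)

theorem finite_mulOp_ne_zero (h : IsLocalized R c ψ) {f : C₀(X, ℂ)} (hf : HasCompactSupport f) :
    {t | mulOp m f (ψ t) ≠ 0}.Finite := by
  refine (finite_preimage_of_isBounded h.tendsto
    (hf.isCompact.isBounded.cthickening (δ := R))).subset fun t ht => ?_
  obtain ⟨x, hx, hxt⟩ := Set.not_disjoint_iff.1 (mt h.mulOp_eq_zero ht)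
  exact Metric.mem_cthickening_of_dist_le _ x _ _ hx (Metric.mem_closedBall'.1 hxt)

theorem hasFinitePropagation_partialIsometry (h : IsLocalized R c ψ) (h' : IsLocalized R' c' ψ')
    {K : ℝ} (hK : ∀ t, dist (c t) (c' t) ≤ K) :
    HasFinitePropagation m (partialIsometry h.orthonormal h'.orthonormal) := by
  refine ⟨max 1 (R' + K + R), lt_max_of_lt_left one_pos, fun f g hfg => ?_⟩
  have hfar (t : T) : mulOp m f (ψ' t) = 0 ∨ mulOp m g (ψ t) = 0 := by
    by_contra! hne
    obtain ⟨x, hxf, hx⟩ := Set.not_disjoint_iff.1 (mt h'.mulOp_eq_zero hne.1)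
    obtain ⟨y, hyg, hy⟩ := Set.not_disjoint_iff.1 (mt h.mulOp_eq_zero hne.2)
    have hxy : R' + K + R < dist x y := (le_max_right _ _).trans_lt (hfg x hxf y hyg)
    have htriangle := dist_triangle4 x (c' t) (c t) y
    rw [dist_comm (c' t)] at htriangle
    linarith [hK t, Metric.mem_closedBall.1 hx, Metric.mem_closedBall'.1 hy]
  ext1 ξ
  have hsum := (hasSum_partialIsometry h.orthonormal h'.orthonormal (mulOp m g ξ)).mapL (mulOp m f)
  refine hsum.unique (hasSum_zero.congr_fun fun t => ?_)
  rw [map_smul]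
  rcases hfar t with hf | hg
  · rw [hf, smul_zero]
  · rw [inner_mulOp_eq_zero hg, zero_smul]

section LocallyCompact

variable [LocallyCompactSpace X]

theorem isCompactOperator_partialIsometry_comp_mulOp (h : IsLocalized R c ψ)
    (h' : Orthonormal ℂ ψ') (f : C₀(X, ℂ)) :
    IsCompactOperator (partialIsometry h.orthonormal h' ∘L mulOp m f) := by
  refine isCompactOperator_of_forall_hasCompactSupport
    (Φ := fun g => partialIsometry h.orthonormal h' ∘L mulOp m g)
    (continuous_const.clm_comp continuous_mulOp) (fun g hg => ?_) f
  refine isCompactOperator_of_hasSum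
    (fun ξ => hasSum_partialIsometry h.orthonormal h' (mulOp m g ξ))
    ((h.finite_mulOp_ne_zero hg).subset ?_)
  rintro t ⟨ξ, hξ⟩ hzero
  exact hξ (by rw [inner_mulOp_eq_zero hzero, zero_smul])

theorem isCompactOperator_mulOp_comp_partialIsometry (h : Orthonormal ℂ ψ)
    (h' : IsLocalized R' c' ψ') (f : C₀(X, ℂ)) :
    IsCompactOperator (mulOp m f ∘L partialIsometry h h'.orthonormal) := by
  refine isCompactOperator_of_forall_hasCompactSupport
    (Φ := fun g => mulOp m g ∘L partialIsometry h h'.orthonormal)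
    (continuous_mulOp.clm_comp continuous_const) (fun g hg => ?_) f
  have hsum (ξ : L2 m) := (hasSum_partialIsometry h h'.orthonormal ξ).mapL (mulOp m g)
  simp only [map_smul] at hsum
  refine isCompactOperator_of_hasSum hsum ((h'.finite_mulOp_ne_zero hg).subset ?_)
  rintro t ⟨ξ, hξ⟩ hzero
  exact hξ (by rw [hzero, smul_zero])

theorem partialIsometry_mem_roeAlgebra (h : IsLocalized R c ψ) (h' : IsLocalized R' c' ψ') {K : ℝ}
    (hK : ∀ t, dist (c t) (c' t) ≤ K) :
    partialIsometry h.orthonormal h'.orthonormal ∈ roeAlgebra m :=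
  subset_closure (NonUnitalStarAlgebra.subset_adjoin ℂ _
    ⟨fun f => ⟨h.isCompactOperator_partialIsometry_comp_mulOp h'.orthonormal f,
      isCompactOperator_mulOp_comp_partialIsometry h.orthonormal h' f⟩,
      h.hasFinitePropagation_partialIsometry h' hK⟩)

end LocallyCompact

end IsLocalized

theorem exists_mulOp_ne_zero_of_mem_essSupport [LocallyCompactSpace X] {ξ : L2 m} {x : X}
    (hx : x ∈ Wannier.essSupport ξ) {U : Set X} (hU : IsOpen U) (hxU : x ∈ U) :
    ∃ f : C₀(X, ℂ), mulOp m f ≠ 0 ∧ ∀ y ∉ U, f y = 0 := by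
  obtain ⟨k, hk_one, hk_zero, hk, -⟩ := exists_continuous_one_zero_of_isCompact isCompact_singleton
    hU.isClosed_compl (Set.disjoint_singleton_left.2 (Set.notMem_compl_iff.2 hxU))
  let f : C(X, ℂ) := ⟨fun y => k y, by fun_prop⟩
  have hf : HasCompactSupport f := hk.comp_left (g := Complex.ofReal) Complex.ofReal_zero
  refine ⟨⟨f, hf.is_zero_at_infty⟩, fun hzero => ?_, fun y hy => ?_⟩
  · refine hx {y | f y ≠ 0} (isOpen_ne_fun f.continuous continuous_const) ?_ ?_
    · simp [f, hk_one rfl]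
    · filter_upwards [mulOp_eq_zero_iff.1 (DFunLike.congr_fun hzero ξ)] with y hy hfy
      exact hy.resolve_left hfy
  · simpa [f] using hk_zero hy

theorem IsAmple.exists_orthonormal [LocallyCompactSpace X] (hm : IsAmple m) {ξ : L2 m} {x : X}
    (hx : x ∈ Wannier.essSupport ξ) {U : Set X} (hU : IsOpen U) (hxU : x ∈ U) :
    ∃ e : ℕ → L2 m, Orthonormal ℂ e ∧ ∀ n, ∀ᵐ y ∂m, y ∉ U → e n y = 0 := by
  obtain ⟨f, hf, hfU⟩ := exists_mulOp_ne_zero_of_mem_essSupport hx hU hxU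
  let V := LinearMap.range (mulOp m f : L2 m →ₗ[ℂ] L2 m)
  have hV : ¬ FiniteDimensional ℂ V :=
    fun _ => hf (hm f (isCompactOperator_of_range_le (V := V) fun η => ⟨η, rfl⟩))
  obtain ⟨e, he, hmem⟩ := exists_orthonormal_nat hV
  refine ⟨e, he, fun n => ?_⟩
  obtain ⟨η, hη⟩ := hmem n
  filter_upwards [mulOp_coeFn m f η] with y hy hyU
  rw [← hη]
  exact hy.trans (by rw [hfU y hyU, zero_mul])

end RoeAlgebra

namespace Wannier

open RoeAlgebra Filter

variable {X : Type*} [MetricSpace X]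

theorem exists_pairwise_disjoint_ball {T : Type*} {c : T → X}
    (hc : Tendsto c cofinite (Bornology.cobounded X)) (hinj : c.Injective) :
    ∃ r : T → ℝ, (∀ t, 0 < r t ∧ r t ≤ 1) ∧
      Pairwise (Function.onFun Disjoint fun t => Metric.ball (c t) (r t)) := by
  have hsep (t : T) : ∃ ε, 0 < ε ∧ ε ≤ 1 ∧ ∀ s ≠ t, ε ≤ dist (c s) (c t) := by
    have hfin := ((finite_preimage_of_isBounded hc
      (Metric.isBounded_ball (x := c t) (r := 1))).sdiff (t := {t})).image c
    have ht : c t ∉ c '' (c ⁻¹' Metric.ball (c t) 1 \ {t}) := by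
      rintro ⟨s, hs, hst⟩
      exact hs.2 (hinj hst)
    obtain ⟨ε, hε, hball⟩ := Metric.isOpen_iff.1 hfin.isClosed.isOpen_compl (c t) ht
    refine ⟨min ε 1, lt_min hε one_pos, min_le_right _ _, fun s hs => ?_⟩
    by_contra! hlt
    exact hball (hlt.trans_le (min_le_left _ _))
      ⟨s, ⟨hlt.trans_le (min_le_right _ _), hs⟩, rfl⟩
  choose ε hpos hle hdist using hsep
  refine ⟨fun t => ε t / 2, fun t => ⟨half_pos (hpos t), by linarith [hpos t, hle t]⟩,
    fun s t hst => Metric.ball_disjoint_ball ?_⟩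
  have hs := hdist s t hst.symm
  rw [dist_comm] at hs
  linarith [hdist t s hst]

variable [MeasurableSpace X] {m : Measure X} {D : Set X}

theorem ae_eq_zero_of_notMem_essSupport [SecondCountableTopology X] (ξ : L2 m) :
    ∀ᵐ x ∂m, x ∉ essSupport ξ → ξ x = 0 := by
  rw [ae_iff]
  refine measure_null_of_locally_null _ fun x hx => ?_
  obtain ⟨hx, -⟩ := Classical.not_imp.1 hx
  simp only [essSupport, Set.mem_ofPred_eq, not_forall, not_not] at hx
  obtain ⟨U, hU, hxU, hzero⟩ := hx
  refine ⟨_, inter_mem_nhdsWithin _ (hU.mem_nhds hxU), measure_mono_null ?_ (ae_iff.1 hzero)⟩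
  rintro y ⟨hy, hyU⟩ himp
  exact hy fun _ => himp hyU

theorem IsWannierBasis.exists_isLocalized [SecondCountableTopology X] {φ : D → L2 m}
    (hφ : IsWannierBasis D φ) (hD : Tendsto ((↑) : D → X) cofinite (Bornology.cobounded X)) :
    ∃ R : ℝ, IsLocalized R ((↑) : D → X) φ := by
  obtain ⟨C, hC⟩ := hφ.bounded
  refine ⟨C, ⟨hφ.norm_eq_one, fun x y hxy => inner_eq_zero_of_ae ?_⟩, fun x => ?_, hD⟩
  · filter_upwards [ae_eq_zero_of_notMem_essSupport (φ x),
      ae_eq_zero_of_notMem_essSupport (φ y)] with z hx hy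
    by_cases hz : z ∈ essSupport (φ x)
    · exact Or.inr (hy (Set.disjoint_left.1 (hφ.disjoint x y hxy) hz))
    · exact Or.inl (hx hz)
  · filter_upwards [ae_eq_zero_of_notMem_essSupport (φ x)] with y hy hball
    exact hy fun hmem => hball (hC x y hmem x (hφ.mem x))

theorem exists_isLocalized_of_mem_essSupport [BorelSpace X] [LocallyCompactSpace X]
    (hm : IsAmple m) (hD : Tendsto ((↑) : D → X) cofinite (Bornology.cobounded X))
    (hsupp : ∀ x : D, ∃ ξ : L2 m, (x : X) ∈ essSupport ξ) {T : Type*} {c : T → D}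
    (hc : Tendsto c cofinite cofinite) :
    ∃ u : T → L2 m, IsLocalized 1 (fun t => (c t : X)) u := by
  have : Countable T := countable_of_tendsto_cobounded (hD.comp hc)
  obtain ⟨i, hi⟩ := exists_injective_nat T
  obtain ⟨r, hr, hdisj⟩ := exists_pairwise_disjoint_ball hD Subtype.coe_injective
  choose ξ hξ using hsupp
  choose e he hzero using fun x =>
    hm.exists_orthonormal (hξ x) Metric.isOpen_ball (Metric.mem_ball_self (hr x).1)
  refine ⟨fun t => e (c t) (i t), ⟨fun t => (he _).1 _, fun s t hst => ?_⟩, fun t => ?_,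
    hD.comp hc⟩
  · by_cases hcst : c s = c t
    · simpa only [hcst] using (he (c t)).2 (hi.ne hst)
    · refine inner_eq_zero_of_ae ?_
      filter_upwards [hzero (c s) (i s), hzero (c t) (i t)] with y hs ht
      by_cases hy : y ∈ Metric.ball (c s : X) (r (c s))
      · exact Or.inr (ht (Set.disjoint_left.1 (hdisj hcst) hy))
      · exact Or.inl (hs hy)
  · filter_upwards [hzero (c t) (i t)] with y hy hball
    exact hy fun hmem =>
      hball (Metric.closedBall_subset_closedBall (hr _).2 (Metric.ball_subset_closedBall hmem))

end Wannier

theorem isCompl_range_prodMk_zero_range_map_succ (ι : Type*) :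
    IsCompl (Set.range fun x : ι => (x, 0)) (Set.range (Prod.map (id : ι → ι) Nat.succ)) := by
  refine ⟨Set.disjoint_left.2 ?_, codisjoint_iff_le_sup.2 ?_⟩
  · rintro _ ⟨x, rfl⟩ ⟨t, ht⟩
    exact Nat.succ_ne_zero _ (congrArg Prod.snd ht)
  · rintro ⟨x, _ | n⟩ -
    exacts [Or.inl ⟨x, rfl⟩, Or.inr ⟨(x, n), rfl⟩]

theorem corollary3p8_general {X : Type*} [MetricSpace X] [MeasurableSpace X] [BorelSpace X]
    [ProperSpace X] [PreconnectedSpace X] [NoncompactSpace X]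
    (m : Measure X) (hample : RoeAlgebra.IsAmple m)
    (D : Set X) (hD : Filter.Tendsto ((↑) : D → X) Filter.cofinite (Bornology.cobounded X))
    (hDX : Wannier.CoarselyDense D) (φ : D → RoeAlgebra.L2 m) (hφ : Wannier.IsWannierBasis D φ) :
    ∃ (p : RoeAlgebra.roeAlgebra m) (hp : IsStarProjection p),
      (p : RoeAlgebra.L2 m →L[ℂ] RoeAlgebra.L2 m) = Wannier.proj φ ∧
        KTheory.K0.mk p hp = 0 := by
  obtain ⟨K, f, hfK, hf⟩ := hDX.exists_tendsto_iterate hD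
  obtain ⟨R, hφR⟩ := hφ.exists_isLocalized hD
  obtain ⟨u, hu⟩ := Wannier.exists_isLocalized_of_mem_essSupport hample hD
    (fun x => ⟨φ x, hφ.mem x⟩) hf
  have hi : Function.Injective fun x : D => (x, 0) := Prod.mk_left_injective 0
  have hj : Function.Injective (Prod.map (id : D → D) Nat.succ) :=
    Function.injective_id.prodMap Nat.succ_injective
  have hv := hφR.partialIsometry_mem_roeAlgebra (hu.comp hi) (K := 0) fun x => (dist_self _).le
  have hw := hu.partialIsometry_mem_roeAlgebra (hu.comp hj) (K := K) fun t => by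
    simpa only [Function.comp_apply, Prod.map, id, Function.iterate_succ_apply'] using hfK _
  obtain ⟨p, hp, hpφ, hp_zero⟩ := KTheory.K0.mk_partialIsometry_eq_zero hφR.orthonormal
    hu.orthonormal hi hj (isCompl_range_prodMk_zero_range_map_succ D) hv hw
  exact ⟨p, hp, hpφ.trans (partialIsometry_self_eq_starProjection _), hp_zero⟩

theorem corollary3p8 {X : Type*} [MetricSpace X] [MeasurableSpace X] [BorelSpace X]
    [ProperSpace X] [ConnectedSpace X] [NoncompactSpace X]
    (m : MeasureTheory.Measure X) (hample : RoeAlgebra.IsAmple m)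
    (hX : Wannier.HasBoundedGeometry X)
    (D : Set X) (hD : Wannier.UniformlyDiscrete D) (hDX : Wannier.CoarselyDense D)
    (φ : D → RoeAlgebra.L2 m) (hφ : Wannier.IsWannierBasis D φ) :
    ∃ (p : RoeAlgebra.roeAlgebra m) (hp : IsStarProjection p),
      (p : RoeAlgebra.L2 m →L[ℂ] RoeAlgebra.L2 m) = Wannier.proj φ ∧
        KTheory.K0.mk p hp = 0 :=
  corollary3p8_general m hample D hD.tendsto_cobounded hDX φ hφ
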